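/- Let $(R,\mathfrak m)$ be a (Noetherian) Cohen–Macaulay local ring of Krull dimension $d\ge 2$ with infinite residue field, and let $I$ be an $\mathfrak m$-primary ideal. Let $H_I(n)=\lambda(R/I^n)$ be the Hilbert–Samuel function of $I$ and let $P_I$ be its Hilbert–Samuel polynomial, i.e. the polynomial with rational coefficients such that $P_I(n)=H_I(n)$ for all sufficiently large $n$. For an ideal $J$ of a ring, let $\widetilde{J}=\bigcup_{n\ge 1}(J^{n+1}:J^n)$ be its Ratliff–Rush closure, and let $\rho(I)=\min\{i\ge 1:\widetilde{I^n}=I^n\text{ for all }n\ge i\}$. An element $x\in J$ is superficial for $J$ if there is a positive integer $c$ with $(J^{n+1}:x)\cap J^c=J^n$ for all $n\ge c$; a sequence $x_1,\dots,x_s\in I$ is a superficial sequence for $I$ if for each $i$ the image of $x_i$ in $R/(x_1,\dots,x_{i-1})$ is superficial for the image of $I$ there. The Ratliff–Rush filtration of $I$ behaves well modulo $x_1,\dots,x_s$ if, with $R_s=R/(x_1,\dots,x_s)$, the image of $\widetilde{I^n}$ in $R_s$ equals $\widetilde{I^nR_s}$ for all $n\ge 1$. Suppose that the Ratliff–Rush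 filtration of $I$ behaves well modulo some superficial sequence $x_1,\dots,x_{d-2}\in I$ for $I$ (no condition if $d=2$). If $P_I(k)=H_I(k)$ for some integer $k\ge\rho(I)$, then $P_I(n)=H_I(n)$ for all $n\ge k$. -/

import Mathlib

open Polynomial IsLocalRing

noncomputable section

/-- A Noetherian local ring is Cohen-Macaulay if some regular sequence inside its maximal ideal
has length equal to the Krull dimension of the ring (that is, depth equals dimension). -/
class IsCohenMacaulayLocal (R : Type*) [CommRing R] [IsLocalRing R] : Prop where
  exists_regular : ∃ rs : List R, (∀ r ∈ rs, r ∈ maximalIdeal R) ∧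
    RingTheory.Sequence.IsRegular R rs ∧ (rs.length : WithBot ℕ∞) = ringKrullDim R

/-- The Hilbert-Samuel function `H_I(n) = λ(R / I ^ n)`. The length is finite for an ideal primary
to the maximal ideal of a Noetherian local ring. -/
def hilbertSamuelFun {R : Type*} [CommRing R] (I : Ideal R) (n : ℕ) : ℕ :=
  (Module.length R (R ⧸ I ^ n)).toNat

open Classical in
/-- The Hilbert-Samuel polynomial `P_I`: the polynomial that agrees with the Hilbert-Samuel
function at all sufficiently large integers (it is unique if it exists). -/
def hilbertSamuelPoly {R : Type*} [CommRing R] (I : Ideal R) : ℚ[X] :=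
  if h : ∃ P : ℚ[X], ∀ᶠ n : ℕ in Filter.atTop, P.eval (n : ℚ) = (hilbertSamuelFun I n : ℚ)
  then h.choose else 0

/-- The Ratliff-Rush closure, the union of the increasing chain of the ideals
`(I ^ (n + 1) : I ^ n)` for `n ≥ 1`. -/
def ratliffRush {R : Type*} [CommRing R] (I : Ideal R) : Ideal R :=
  ⨆ n : ℕ, (I ^ (n + 2)).colon ((I ^ (n + 1) : Ideal R) : Set R)

theorem mem_ratliffRush {R : Type*} [CommRing R] (I : Ideal R) (r : R) :
    r ∈ ratliffRush I ↔ ∃ n : ℕ, 1 ≤ n ∧ ∀ s ∈ I ^ n, r * s ∈ I ^ (n + 1) := by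
  have hmono : Monotone
      (fun n : ℕ => (I ^ (n + 2)).colon ((I ^ (n + 1) : Ideal R) : Set R)) := by
    refine monotone_nat_of_le_succ fun n r hr => ?_
    rw [Submodule.mem_colon] at hr ⊢
    intro s hs
    have hs' : s ∈ I ^ (n + 1) * I := by rw [← pow_succ]; exact hs
    rw [smul_eq_mul, pow_succ]
    refine Submodule.mul_induction_on hs' (fun a ha b hb => ?_) (fun a b ha hb => ?_)
    · rw [← mul_assoc]
      exact Ideal.mul_mem_mul (hr a ha) hb
    · rw [mul_add]
      exact Ideal.add_mem _ ha hb
  unfold ratliffRush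
  rw [Submodule.mem_iSup_of_directed _ hmono.directed_le]
  simp only [Submodule.mem_colon, smul_eq_mul, SetLike.mem_coe]
  constructor
  · rintro ⟨n, hn⟩
    exact ⟨n + 1, by omega, hn⟩
  · rintro ⟨n, h1, hn⟩
    obtain ⟨m, rfl⟩ := Nat.exists_eq_add_of_le' h1
    exact ⟨m, hn⟩

/-- The stability index `ρ(I)` of the Ratliff-Rush filtration: the least `i ≥ 1` such that
`I ^ n` is Ratliff-Rush closed for all `n ≥ i`. -/
def stabilityIndex {R : Type*} [CommRing R] (I : Ideal R) : ℕ :=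
  sInf {i : ℕ | 1 ≤ i ∧ ∀ n, i ≤ n → ratliffRush (I ^ n) = I ^ n}

/-- `x ∈ I` is superficial for `I`: for some positive integer `c`,
`(I ^ (n + 1) : x) ∩ I ^ c = I ^ n` for all `n ≥ c`. -/
def IsSuperficial {R : Type*} [CommRing R] (I : Ideal R) (x : R) : Prop :=
  x ∈ I ∧ ∃ c : ℕ, 0 < c ∧ ∀ n, c ≤ n → (I ^ (n + 1)).colon {x} ⊓ I ^ c = I ^ n

/-- `x` is a superficial sequence for `I`: each `x i` is, modulo the earlier terms, superficial
for the image of `I`. -/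
def IsSuperficialSeq {R : Type*} [CommRing R] (I : Ideal R) {s : ℕ} (x : Fin s → R) : Prop :=
  ∀ i : Fin s, IsSuperficial
    (I.map (Ideal.Quotient.mk (Ideal.span (x '' {j | j < i}))))
    (Ideal.Quotient.mk (Ideal.span (x '' {j | j < i})) (x i))

/-- The Ratliff-Rush filtration of `I` behaves well modulo the sequence `x`: for every `n ≥ 1`, the
image of the Ratliff-Rush closure of `I ^ n` in `R / (x)` is the Ratliff-Rush closure of the image
of `I ^ n`. -/
def RatliffRushBehavesWell {R : Type*} [CommRing R] (I : Ideal R) {s : ℕ} (x : Fin s → R) :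
    Prop :=
  ∀ n : ℕ, 1 ≤ n →
    (ratliffRush (I ^ n)).map (Ideal.Quotient.mk (Ideal.span (Set.range x))) =
      ratliffRush ((I ^ n).map (Ideal.Quotient.mk (Ideal.span (Set.range x))))

end

/-!
For `n ≥ ρ(I)` the Hilbert–Samuel function `H_I(n)` equals `F(n) = λ(R / J n)`, where `J` is the
Ratliff–Rush filtration of `I`. If `x` is superficial then `(J (n + 1) : x) = J n` for *every* `n`,
so the first difference of `F` is, up to a shift, the Hilbert function of the image of `J` modulo
`x`. Good behaviour modulo the whole sequence descends to its initial segments, so after `d - 2`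
steps one is left with the Hilbert function of the Ratliff–Rush filtration of a two-dimensional
Cohen–Macaulay module. One more superficial element leads to dimension one. There the first
difference is at most the length of the quotient by a superficial element, with equality
eventually.

Hence `Δ^d F` never exceeds its eventual value, which is the constant `Δ^d P_I`. As `P_I - F`
vanishes eventually and `Δ^d (P_I - F) ≥ 0`, the function `(-1)^(d - 1) (P_I - F)` is monotone and
hence vanishes from any of its zeros on.
-/

open CategoryTheory Abelian RingTheory.Sequence Filter Pointwise fwdDiff

universe u v

section CohenMacaulay

variable {R : Type u} [CommRing R] [IsLocalRing R] {M : Type v} [AddCommGroup M] [Module R M]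

/-- A Cohen–Macaulay module of dimension `n` over a local ring: its support has dimension `n`, and
the maximal ideal contains a regular sequence of length `n` on it. -/
structure IsCohenMacaulayOfDim (R : Type u) [CommRing R] [IsLocalRing R] (M : Type v)
    [AddCommGroup M] [Module R M] (n : ℕ) : Prop where
  supportDim_eq : Module.supportDim R M = n
  exists_isRegular : ∃ rs : List R, rs.length = n ∧ (∀ r ∈ rs, r ∈ maximalIdeal R) ∧ IsRegular M rs

namespace IsCohenMacaulayOfDim

theorem congr {M' : Type*} [AddCommGroup M'] [Module R M'] {n : ℕ} (h : IsCohenMacaulayOfDim R M n)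
    (e : M ≃ₗ[R] M') : IsCohenMacaulayOfDim R M' n where
  supportDim_eq := (Module.supportDim_eq_of_equiv e).symm.trans h.supportDim_eq
  exists_isRegular := by
    obtain ⟨rs, hlen, hmem, hreg⟩ := h.exists_isRegular
    exact ⟨rs, hlen, hmem, (e.isRegular_congr rs).1 hreg⟩

theorem nontrivial {n : ℕ} (h : IsCohenMacaulayOfDim R M n) : Nontrivial M := by
  obtain ⟨_, -, -, hreg⟩ := h.exists_isRegular
  exact hreg.nontrivial

theorem maximalIdeal_le_radical_annihilator [Module.Finite R M]
    (h : IsCohenMacaulayOfDim R M 0) : maximalIdeal R ≤ (Module.annihilator R M).radical := by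
  have hsupp := support_of_supportDim_eq_zero R M h.supportDim_eq
  rw [Module.support_eq_zeroLocus, PrimeSpectrum.zeroLocus_eq_iff] at hsupp
  exact hsupp ▸ Ideal.le_radical

theorem exists_isSMulRegular {n : ℕ} (h : IsCohenMacaulayOfDim R M (n + 1)) :
    ∃ r ∈ maximalIdeal R, IsSMulRegular M r := by
  obtain ⟨_ | ⟨r, rs⟩, hlen, hmem, hreg⟩ := h.exists_isRegular
  · simp at hlen
  · exact ⟨r, hmem r List.mem_cons_self, ((isRegular_cons_iff M r rs).1 hreg).1⟩

theorem quotSMulTop [Small.{v} R] [IsNoetherianRing R] [Module.Finite R M] {n : ℕ}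
    (h : IsCohenMacaulayOfDim R M (n + 1)) {x : R} (hx : x ∈ maximalIdeal R)
    (hreg : IsSMulRegular M x) : IsCohenMacaulayOfDim R (QuotSMulTop x M) n := by
  have := h.nontrivial
  have := nontrivial_quotSMulTop_of_mem_maximalIdeal M hx
  have smul_lt (N : Type v) [AddCommGroup N] [Module R N] [Module.Finite R N] [Nontrivial N] :
      maximalIdeal R • (⊤ : Submodule R N) < ⊤ :=
    (Submodule.top_ne_ideal_smul_of_le_jacobson_annihilator
      (maximalIdeal_le_jacobson _)).symm.lt_top
  refine ⟨?_, ?_⟩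
  · have := Module.supportDim_quotSMulTop_succ_eq_supportDim hreg hx
    rw [h.supportDim_eq, Nat.cast_add, Nat.cast_one] at this
    exact (ENat.WithBot.add_one_cancel).1 this
  -- Depth is read off the vanishing of `Ext`, so `x` need not start the given regular sequence.
  · have ext_vanishing := ((ModuleCat.exists_isRegular_tfae (maximalIdeal R) (n + 1)
      (ModuleCat.of R M) (smul_lt M)).out 3 1).1 h.exists_isRegular
    refine ((ModuleCat.exists_isRegular_tfae (maximalIdeal R) n
      (ModuleCat.of R (QuotSMulTop x M)) (smul_lt _)).out 1 3).1 fun i hi => ?_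
    exact AddCommGrpCat.subsingleton_of_isZero <| ShortComplex.Exact.isZero_of_both_zeros
      (Ext.covariant_sequence_exact₃' _
        (hreg.smulShortComplex_shortExact (M := ModuleCat.of R M)) i (i + 1) rfl)
      ((AddCommGrpCat.isZero_of_iff_subsingleton.mpr (ext_vanishing i (by lia))).eq_zero_of_src _)
      ((AddCommGrpCat.isZero_of_iff_subsingleton.mpr
        (ext_vanishing (i + 1) (by lia))).eq_zero_of_tgt _)

theorem of_exact [Small.{v} R] [IsNoetherianRing R] [Module.Finite R M] {n : ℕ}
    (h : IsCohenMacaulayOfDim R M (n + 1)) {x : R} (hx : x ∈ maximalIdeal R)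
    (hreg : IsSMulRegular M x) {M' : Type*} [AddCommGroup M'] [Module R M'] {g : M →ₗ[R] M'}
    (hexact : Function.Exact (LinearMap.lsmul R M x) g) (hg : Function.Surjective g) :
    IsCohenMacaulayOfDim R M' n :=
  (h.quotSMulTop hx hreg).congr <|
    (Submodule.quotEquivOfEq _ _ <| by
      rw [LinearMap.exact_iff.1 hexact, LinearMap.range_eq_map]; rfl).trans
    (g.quotKerEquivOfSurjective hg)

end IsCohenMacaulayOfDim

end CohenMacaulay

section RatliffRush

variable {R : Type*} [CommRing R] {I : Ideal R}
  {M : Type*} [AddCommGroup M] [Module R M] {M' : Type*} [AddCommGroup M'] [Module R M']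
  {M'' : Type*} [AddCommGroup M''] [Module R M'']

theorem forall_pow_smul_mem_of_le {n N N' : ℕ} {m : M}
    (h : ∀ s ∈ I ^ N, s • m ∈ (I ^ (n + N) • ⊤ : Submodule R M)) (hN : N ≤ N') :
    ∀ s ∈ I ^ N', s • m ∈ (I ^ (n + N') • ⊤ : Submodule R M) := by
  induction N', hN using Nat.le_induction with
  | base => exact h
  | succ k _ ih =>
    intro s hs
    rw [pow_succ'] at hs
    induction hs using Submodule.mul_induction_on' with
    | mem_mul_mem a ha b hb =>
      rw [← add_assoc, pow_succ', mul_smul, mul_smul]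
      exact Submodule.smul_mem_smul ha (ih b hb)
    | add a _ b _ ha hb => exact add_smul a b m ▸ add_mem ha hb

/-- The Ratliff–Rush filtration `n ↦ ⋃ N, (I ^ (n + N) • M : I ^ N)` of a module. For the ring
itself its terms of degree `n ≥ 1` are the Ratliff–Rush closures of the powers `I ^ n`. -/
def ratliffRushFiltration (I : Ideal R) (M : Type*) [AddCommGroup M] [Module R M] :
    I.Filtration M where
  N n :=
    { carrier := {m | ∃ N : ℕ, ∀ s ∈ I ^ N, s • m ∈ (I ^ (n + N) • ⊤ : Submodule R M)}
      zero_mem' := ⟨0, by simp⟩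
      add_mem' := fun {a b} ⟨N, ha⟩ ⟨N', hb⟩ => ⟨max N N', fun s hs => by
        rw [smul_add]
        exact add_mem (forall_pow_smul_mem_of_le ha (le_max_left _ _) s hs)
          (forall_pow_smul_mem_of_le hb (le_max_right _ _) s hs)⟩
      smul_mem' := fun r m ⟨N, hN⟩ => ⟨N, fun s hs => by
        rw [smul_comm]
        exact Submodule.smul_mem _ r (hN s hs)⟩ }
  mono n _ := fun ⟨N, hN⟩ => ⟨N, fun s hs =>
    Submodule.smul_mono_left (Ideal.pow_le_pow_right (by lia)) (hN s hs)⟩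
  smul_le n := Submodule.smul_le.2 fun a ha _ ⟨N, hN⟩ => ⟨N, fun s hs => by
    rw [smul_comm, show n + 1 + N = (n + N) + 1 by ring, pow_succ', mul_smul]
    exact Submodule.smul_mem_smul ha (hN s hs)⟩

theorem mem_ratliffRushFiltration {n : ℕ} {m : M} : m ∈ (ratliffRushFiltration I M).N n ↔
    ∃ N : ℕ, ∀ s ∈ I ^ N, s • m ∈ (I ^ (n + N) • ⊤ : Submodule R M) := Iff.rfl

theorem pow_smul_top_le_ratliffRushFiltration (I : Ideal R) (n : ℕ) :
    I ^ n • ⊤ ≤ (ratliffRushFiltration I M).N n :=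
  fun _ hm => ⟨0, fun s _ => Submodule.smul_mem _ s hm⟩

theorem ratliffRushFiltration_zero : (ratliffRushFiltration I M).N 0 = ⊤ :=
  top_le_iff.1 (by simpa using pow_smul_top_le_ratliffRushFiltration (M := M) I 0)

theorem map_ratliffRushFiltration_le (f : M →ₗ[R] M') (n : ℕ) :
    ((ratliffRushFiltration I M).N n).map f ≤ (ratliffRushFiltration I M').N n := by
  rintro _ ⟨m, ⟨N, hN⟩, rfl⟩
  exact ⟨N, fun s hs => by
    simpa using Submodule.smul_top_le_comap_smul_top (I ^ (n + N)) f (hN s hs)⟩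

theorem ratliffRush_pow_eq (I : Ideal R) {n : ℕ} (hn : 1 ≤ n) :
    ratliffRush (I ^ n) = (ratliffRushFiltration I R).N n := by
  ext r
  simp only [mem_ratliffRush, mem_ratliffRushFiltration, ← pow_mul, smul_eq_mul, Ideal.mul_top,
    mul_comm r]
  constructor
  · rintro ⟨N, -, hN⟩
    exact ⟨n * N, fun s hs => by simpa [mul_add, add_comm] using hN s hs⟩
  · rintro ⟨N, hN⟩
    refine ⟨N + 1, by lia, fun s hs => ?_⟩
    have := forall_pow_smul_mem_of_le (M := R) (N' := n * (N + 1)) (by simpa using hN)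
      (by nlinarith) s hs
    simpa [mul_add, add_comm] using this

theorem mem_ratliffRushFiltration_map {S : Type*} [CommRing S] [Algebra R S] {n : ℕ} {r : S} :
    r ∈ (ratliffRushFiltration (I.map (algebraMap R S)) S).N n ↔
      r ∈ (ratliffRushFiltration I S).N n := by
  simp only [mem_ratliffRushFiltration, Ideal.smul_top_eq_map, ← Ideal.map_pow,
    Submodule.restrictScalars_mem, smul_eq_mul, Ideal.mul_top]
  refine exists_congr fun N => ?_
  simpa [SetLike.le_def, Submodule.mem_colon_singleton, Algebra.smul_def] using
    Ideal.map_le_iff_le_comap (f := algebraMap R S) (I := I ^ N)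
      (K := ((I ^ (n + N)).map (algebraMap R S)).colon {r})

/-- `x` is a superficial element of `I` on the module `M`. The inclusion opposite to the one
required here always holds. -/
structure IsSuperficialOn (I : Ideal R) (M : Type*) [AddCommGroup M] [Module R M] (x : R) :
    Prop where
  mem : x ∈ I
  exists_comap_inf_le : ∃ c, ∀ n ≥ c,
    (I ^ (n + 1) • ⊤ : Submodule R M).comap (LinearMap.lsmul R M x) ⊓ I ^ c • ⊤ ≤ I ^ n • ⊤

namespace IsSuperficialOn

variable {x : R}

theorem comap_ratliffRushFiltration (h : IsSuperficialOn I M x) (n : ℕ) :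
    ((ratliffRushFiltration I M).N (n + 1)).comap (LinearMap.lsmul R M x) =
      (ratliffRushFiltration I M).N n := by
  refine le_antisymm (fun m ⟨N, hN⟩ => ?_) fun m hm =>
    (ratliffRushFiltration I M).smul_le n (Submodule.smul_mem_smul h.mem hm)
  obtain ⟨c, hc⟩ := h.exists_comap_inf_le
  refine ⟨c + N, fun s hs => hc _ (by lia) ⟨?_, ?_⟩⟩
  · have := forall_pow_smul_mem_of_le hN (show N ≤ c + N by lia) s hs
    rwa [SetLike.mem_coe, Submodule.mem_comap, map_smul,
      show n + (c + N) + 1 = n + 1 + (c + N) by ring]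
  · exact Submodule.smul_mem_smul (Ideal.pow_le_pow_right (by lia) hs) Submodule.mem_top

theorem map_ratliffRushFiltration_eq (h : IsSuperficialOn I M x) {f : M'' →ₗ[R] M}
    (hf : Function.Surjective f) {g : M →ₗ[R] M'}
    (hexact : Function.Exact (LinearMap.lsmul R M x) g)
    (hgf : ∀ n, ((ratliffRushFiltration I M'').N n).map (g ∘ₗ f) = (ratliffRushFiltration I M').N n)
    (n : ℕ) :
    ((ratliffRushFiltration I M'').N n).map f = (ratliffRushFiltration I M).N n := by
  refine (map_ratliffRushFiltration_le f n).antisymm ?_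
  induction n with
  | zero =>
    rw [ratliffRushFiltration_zero, ratliffRushFiltration_zero, Submodule.map_top,
      LinearMap.range_eq_top.2 hf]
  | succ n ih =>
    intro m hm
    have hgm := map_ratliffRushFiltration_le g _ (Submodule.mem_map_of_mem hm)
    rw [← hgf] at hgm
    obtain ⟨u, hu, hgu⟩ := hgm
    obtain ⟨t, ht⟩ := (hexact (m - f u)).1 (by rw [map_sub, ← hgu]; simp)
    have hxt : t ∈ (ratliffRushFiltration I M).N n := by
      rw [← h.comap_ratliffRushFiltration, Submodule.mem_comap, ht]
      exact sub_mem hm (map_ratliffRushFiltration_le f _ (Submodule.mem_map_of_mem hu))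
    obtain ⟨v, hv, rfl⟩ := ih hxt
    refine ⟨u + x • v, add_mem hu ?_, ?_⟩
    · exact (ratliffRushFiltration I M'').smul_le n (Submodule.smul_mem_smul h.mem hv)
    · rw [map_add, map_smul, ← LinearMap.lsmul_apply x (f v), ht, add_sub_cancel]

end IsSuperficialOn

theorem IsSuperficial.isSuperficialOn {S : Type*} [CommRing S] [Algebra R S] {x : R} (hx : x ∈ I)
    (h : IsSuperficial (I.map (algebraMap R S)) (algebraMap R S x)) : IsSuperficialOn I S x := by
  obtain ⟨-, c, -, hc⟩ := h
  refine ⟨hx, c, fun n hn r ⟨hr, hrc⟩ => ?_⟩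
  simp only [Ideal.smul_top_eq_map, Ideal.map_pow] at hr hrc ⊢
  rw [← hc n hn]
  refine ⟨?_, hrc⟩
  simpa [Submodule.mem_colon_singleton, Algebra.smul_def, mul_comm] using hr

end RatliffRush

section Existence

variable {R : Type*} [CommRing R] {M : Type*} [AddCommGroup M] [Module R M]

theorem exists_forall_notMem_of_infinite_residueField [IsLocalRing R] [Infinite (ResidueField R)]
    [Module.Finite R M] {ι : Type*} {s : Set ι} (hs : s.Finite) (N : ι → Submodule R M)
    (hN : ∀ i ∈ s, N i ≠ ⊤) : ∃ m, ∀ i ∈ s, m ∉ N i := by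
  by_contra! hcov
  let 𝔪 : Submodule R M := maximalIdeal R • ⊤
  obtain ⟨i, hi, hfin⟩ := Submodule.exists_finiteIndex_of_cover (s := hs.toFinset)
    (p := fun i => N i ⊔ 𝔪) <| Set.eq_univ_of_forall fun m => by
      obtain ⟨i, hi, hm⟩ := hcov m
      exact Set.mem_biUnion (hs.mem_toFinset.2 hi) ((le_sup_left : N i ≤ N i ⊔ 𝔪) hm)
  have hne : N i ⊔ 𝔪 ≠ ⊤ := fun h => hN i (hs.mem_toFinset.1 hi) <| top_le_iff.1 <|
    Submodule.le_of_le_smul_of_le_jacobson_bot Module.Finite.fg_top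
      (maximalIdeal_le_jacobson _) h.ge
  have : Finite (M ⧸ N i ⊔ 𝔪) := AddSubgroup.finite_quotient_of_finiteIndex
  have : Nontrivial (M ⧸ N i ⊔ 𝔪) := Submodule.Quotient.nontrivial_iff.2 hne
  let _ : Module (ResidueField R) (M ⧸ N i ⊔ 𝔪) :=
    Module.IsTorsionBySet.module (I := maximalIdeal R) (by
      rintro z ⟨a, ha⟩
      obtain ⟨m, rfl⟩ := Submodule.mkQ_surjective _ z
      rw [← map_smul, Submodule.mkQ_apply, Submodule.Quotient.mk_eq_zero]
      exact le_sup_right (a := N i) (Submodule.smul_mem_smul ha Submodule.mem_top))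
  exact (Module.Free.infinite (ResidueField R) (M ⧸ N i ⊔ 𝔪)).not_finite ‹_›

theorem exists_pow_smul_eq_zero_of_associatedPrimes [IsNoetherianRing R] [Module.Finite R M]
    {P : Ideal R} {y : R} (hy : ∀ Q ∈ associatedPrimes R M, y ∈ Q → P ≤ Q) :
    ∃ c, ∀ m : M, y • m = 0 → ∀ p ∈ P ^ c, p • m = 0 := by
  let K := LinearMap.ker (LinearMap.lsmul R M y)
  have hyK : y ∈ Module.annihilator R K := Module.mem_annihilator.2 fun m => Subtype.ext m.2
  have hP : P ≤ (Module.annihilator R K).radical := by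
    rw [← Ideal.sInf_minimalPrimes]
    refine le_sInf fun Q hQ => hy Q ?_ (hQ.1.2 hyK)
    exact associatedPrimes.subset_of_injective K.injective_subtype
      (Module.associatedPrimes.minimalPrimes_annihilator_subset_associatedPrimes R K hQ)
  obtain ⟨c, hc⟩ := Ideal.exists_pow_le_of_le_radical_of_fg hP (IsNoetherian.noetherian P)
  exact ⟨c, fun m hm p hp => congrArg Subtype.val (Module.mem_annihilator.1 (hc hp) ⟨m, hm⟩)⟩

theorem exists_forall_smul_eq_zero_imp_pow_smul_eq_zero [IsLocalRing R]
    [Infinite (ResidueField R)] [Module.Finite R M] {S : Type*} [CommRing S] [IsNoetherianRing S]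
    [Algebra R S] (φ : M →ₗ[R] S) (L : Type*) [AddCommGroup L] [Module S L] [Module.Finite S L] :
    ∃ a c, ∀ z : L, φ a • z = 0 → ∀ p ∈ Ideal.span (Set.range φ) ^ c, p • z = 0 := by
  obtain ⟨a, ha⟩ := exists_forall_notMem_of_infinite_residueField
    ((associatedPrimes.finite S L).subset
      (Set.sep_subset _ fun Q => ¬Ideal.span (Set.range φ) ≤ Q))
    (fun Q => (Q.restrictScalars R).comap φ)
    fun Q hQ htop => hQ.2 <| Ideal.span_le.2 <| Set.range_subset_iff.2 fun b =>
      (htop ▸ Submodule.mem_top : b ∈ (Q.restrictScalars R).comap φ)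
  exact ⟨a, exists_pow_smul_eq_zero_of_associatedPrimes fun Q hQ haQ =>
    by_contra fun hPQ => ha Q ⟨hQ, hPQ⟩ haQ⟩

/-- The homogeneous element `a t ^ n` of the Rees algebra, for `a ∈ I ^ n`. -/
noncomputable def reesMonomial (I : Ideal R) (n : ℕ) : ↥(I ^ n) →ₗ[R] reesAlgebra I :=
  ((monomial n).comp (I ^ n).subtype).codRestrict (Subalgebra.toSubmodule (reesAlgebra I))
    fun a => reesAlgebra.monomial_mem.2 a.2

theorem reesMonomial_mem_pow (I : Ideal R) (n : ℕ) (a : ↥(I ^ n)) :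
    reesMonomial I n a ∈ Ideal.span (Set.range (reesMonomial I 1)) ^ n := by
  obtain ⟨r, hr⟩ := a
  induction n generalizing r with
  | zero => simp
  | succ n ih =>
    induction (pow_succ I n ▸ hr : r ∈ I ^ n * I) using Submodule.mul_induction_on' with
    | mem_mul_mem a ha b hb =>
      have hmul : reesMonomial I (n + 1) ⟨a * b, hr⟩ =
          reesMonomial I n ⟨a, ha⟩ * reesMonomial I 1 ⟨b, by simpa using hb⟩ :=
        Subtype.ext (monomial_mul_monomial n 1 a b).symm
      rw [hmul, pow_succ]
      exact Ideal.mul_mem_mul (ih a ha) (Ideal.subset_span ⟨_, rfl⟩)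
    | add a ha b hb iha ihb =>
      rw [← pow_succ] at ha hb
      exact (reesMonomial I (n + 1)).map_add ⟨a, ha⟩ ⟨b, hb⟩ ▸ add_mem (iha ha) (ihb hb)

/-- The shifted adic filtration `n ↦ I ^ (n + 1) • M`. Together with the adic filtration it
computes the associated graded module. -/
@[simps]
def shiftedAdicFiltration (I : Ideal R) (M : Type*) [AddCommGroup M] [Module R M] :
    I.Filtration M where
  N n := I ^ (n + 1) • ⊤
  mono n := Submodule.smul_mono_left (Ideal.pow_le_pow_right (by lia))
  smul_le n := by rw [← mul_smul, ← pow_succ']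

theorem exists_forall_smul_mem_imp_pow_smul_mem [IsLocalRing R] [IsNoetherianRing R]
    [Infinite (ResidueField R)] (I : Ideal R) (M : Type*) [AddCommGroup M] [Module R M]
    [Module.Finite R M] :
    ∃ x ∈ I, ∃ c, ∀ m, ∀ z ∈ (I ^ m • ⊤ : Submodule R M),
      x • z ∈ (I ^ (m + 2) • ⊤ : Submodule R M) →
        ∀ a ∈ I ^ c, a • z ∈ (I ^ (c + m + 1) • ⊤ : Submodule R M) := by
  let F := (I.stableFiltration (⊤ : Submodule R M)).submodule
  let F' := (shiftedAdicFiltration I M).submodule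
  have : Module.Finite (reesAlgebra I) (F.map F'.mkQ) := Module.Finite.iff_fg.2 <|
    ((Ideal.Filtration.submodule_fg_iff_stable _ fun _ => IsNoetherian.noetherian _).2
      (I.stableFiltration_stable ⊤)).map _
  obtain ⟨⟨x, hxI⟩, c, hc⟩ :=
    exists_forall_smul_eq_zero_imp_pow_smul_eq_zero (reesMonomial I 1) (F.map F'.mkQ)
  have single_mem (𝓕 : I.Filtration M) (m : ℕ) (z : M) :
      PolynomialModule.single R m z ∈ 𝓕.submodule ↔ z ∈ 𝓕.N m := by
    rw [Ideal.Filtration.mem_submodule]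
    refine ⟨fun h => by simpa using h m, fun h j => ?_⟩
    rcases eq_or_ne m j with rfl | hj
    · simpa using h
    · simp [Finsupp.single_eq_of_ne hj.symm]
  have smul_single_mem {n m : ℕ} (a : ↥(I ^ n)) (z : M) :
      reesMonomial I n a • PolynomialModule.single R m z ∈ F' ↔
        (a : R) • z ∈ (I ^ (n + m + 1) • ⊤ : Submodule R M) := by
    rw [← shiftedAdicFiltration_N, ← single_mem, ← PolynomialModule.monomial_smul_single]
    rfl
  refine ⟨x, by simpa using hxI, c, fun m z hz hxz a ha => ?_⟩
  have hzF : PolynomialModule.single R m z ∈ F := (single_mem _ _ _).2 hz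
  have hkill := hc ⟨F'.mkQ (PolynomialModule.single R m z), Submodule.mem_map_of_mem hzF⟩
    (Subtype.ext <| (Submodule.Quotient.mk_eq_zero F').2 <|
      (smul_single_mem _ z).2 (by convert hxz using 3; ring))
    _ (reesMonomial_mem_pow I c ⟨a, ha⟩)
  exact (smul_single_mem ⟨a, ha⟩ z).1
    ((Submodule.Quotient.mk_eq_zero F').1 (congrArg Subtype.val hkill))

/-- The filtration of `M` by the elements `z ∈ I ^ n • M` with `x • z ∈ I ^ (n + 2) • M`. For
`x ∈ I` these are the elements whose initial form in the associated graded module is annihilated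
by the initial form of `x`. -/
def initialAnnihilatorFiltration (I : Ideal R) (M : Type*) [AddCommGroup M] [Module R M] (x : R) :
    I.Filtration M where
  N n := I ^ n • ⊤ ⊓ (I ^ (n + 2) • ⊤ : Submodule R M).comap (LinearMap.lsmul R M x)
  mono n := inf_le_inf (Submodule.smul_mono_left (Ideal.pow_le_pow_right (by lia)))
    (Submodule.comap_mono (Submodule.smul_mono_left (Ideal.pow_le_pow_right (by lia))))
  smul_le n := Submodule.smul_le.2 fun a ha z ⟨hz, hxz⟩ => by
    refine ⟨?_, ?_⟩
    · rw [SetLike.mem_coe, pow_succ', mul_smul]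
      exact Submodule.smul_mem_smul ha hz
    · rw [SetLike.mem_coe, Submodule.mem_comap, map_smul, add_right_comm, pow_succ', mul_smul]
      exact Submodule.smul_mem_smul ha hxz

theorem exists_isSuperficialOn [IsLocalRing R] [IsNoetherianRing R] [Infinite (ResidueField R)]
    (I : Ideal R) (M : Type*) [AddCommGroup M] [Module R M] [Module.Finite R M] :
    ∃ x, IsSuperficialOn I M x := by
  obtain ⟨x, hx, c, hc⟩ := exists_forall_smul_mem_imp_pow_smul_mem I M
  obtain ⟨n₀, hn₀⟩ := ((I.stableFiltration_stable (⊤ : Submodule R M)).of_le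
    (F' := initialAnnihilatorFiltration I M x) fun n => inf_le_left).exists_pow_smul_eq
  have smul_mem_succ {n : ℕ} (hn : n₀ + c ≤ n) {z : M} (hz : z ∈ (I ^ n • ⊤ : Submodule R M))
      (hxz : x • z ∈ (I ^ (n + 2) • ⊤ : Submodule R M)) :
      z ∈ (I ^ (n + 1) • ⊤ : Submodule R M) := by
    obtain ⟨k, rfl⟩ := Nat.exists_eq_add_of_le hn
    have hzN : z ∈ (initialAnnihilatorFiltration I M x).N (n₀ + c + k) := ⟨hz, hxz⟩
    rw [add_assoc, hn₀, pow_add, mul_smul, ← hn₀] at hzN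
    have hle : I ^ c • (initialAnnihilatorFiltration I M x).N (n₀ + k) ≤
        (I ^ (n₀ + c + k + 1) • ⊤ : Submodule R M) := Submodule.smul_le.2 fun a ha w hw => by
      convert hc _ w hw.1 hw.2 a ha using 3
      ring
    exact hle hzN
  refine ⟨x, hx, n₀ + c, fun n hn => ?_⟩
  induction n, hn using Nat.le_induction with
  | base => exact inf_le_right
  | succ n hn ih =>
    refine fun z ⟨hxz, hz⟩ => smul_mem_succ hn (ih ⟨?_, hz⟩) hxz
    exact Submodule.smul_mono_left (Ideal.pow_le_pow_right (by lia)) hxz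

namespace IsSuperficialOn

variable [IsNoetherianRing R] [Module.Finite R M] {I : Ideal R} {x : R}

theorem isSMulRegular [IsLocalRing R] (h : IsSuperficialOn I M x) (hI : I ≠ ⊤) {r : R}
    (hr : r ∈ I.radical) (hreg : IsSMulRegular M r) : IsSMulRegular M x := by
  obtain ⟨c, hc⟩ := h.exists_comap_inf_le
  obtain ⟨k, hk⟩ := hr
  refine isSMulRegular_iff_right_eq_zero_of_smul.2 fun z hz => ?_
  have hbot : r ^ (k * c) • z ∈ (⨅ n, I ^ n • ⊤ : Submodule R M) := by
    refine (Submodule.mem_iInf _).2 fun n => ?_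
    refine Submodule.smul_mono_left (Ideal.pow_le_pow_right (le_max_left n c))
      (hc (max n c) (le_max_right n c) ⟨?_, ?_⟩)
    · simp [hz]
    · exact Submodule.smul_mem_smul (pow_mul r k c ▸ Ideal.pow_mem_pow hk c) Submodule.mem_top
  rw [Ideal.iInf_pow_smul_eq_bot_of_isLocalRing I hI, Submodule.mem_bot] at hbot
  exact (hreg.pow _).right_eq_zero_of_smul hbot

theorem isSMulRegular_of_isCohenMacaulayOfDim [IsLocalRing R] (h : IsSuperficialOn I M x)
    (hI : I.radical = maximalIdeal R) {n : ℕ} (hM : IsCohenMacaulayOfDim R M (n + 1)) :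
    IsSMulRegular M x := by
  obtain ⟨r, hr, hreg⟩ := hM.exists_isSMulRegular
  refine h.isSMulRegular ?_ (hI ▸ hr) hreg
  rintro rfl
  exact (maximalIdeal.isMaximal R).ne_top (hI.symm.trans (Ideal.radical_top R))

theorem eventually_comap_eq (h : IsSuperficialOn I M x) (hreg : IsSMulRegular M x) :
    ∀ᶠ n in atTop, (I ^ (n + 1) • ⊤ : Submodule R M).comap (LinearMap.lsmul R M x) =
      I ^ n • ⊤ := by
  obtain ⟨c, hc⟩ := h.exists_comap_inf_le
  obtain ⟨k, hk⟩ := I.exists_pow_inf_eq_pow_smul (LinearMap.range (LinearMap.lsmul R M x))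
  filter_upwards [eventually_ge_atTop (k + c)] with n hn
  refine le_antisymm (fun z hz => hc n (by lia) ⟨hz, ?_⟩) fun z hz => ?_
  · have hxz : x • z ∈ I ^ (n + 1) • ⊤ ⊓ LinearMap.range (LinearMap.lsmul R M x) := ⟨hz, z, rfl⟩
    rw [hk (n + 1) (by lia)] at hxz
    obtain ⟨w, hw, hwz⟩ : x • z ∈ (I ^ (n + 1 - k) • ⊤ : Submodule R M).map
        (LinearMap.lsmul R M x) := by
      rw [Submodule.map_smul'', Submodule.map_top]
      exact (smul_mono_right _ inf_le_right : _ ≤ I ^ (n + 1 - k) • LinearMap.range _) hxz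
    exact hreg hwz ▸ Submodule.smul_mono_left (Ideal.pow_le_pow_right (by lia)) hw
  · rw [Submodule.mem_comap, pow_succ', mul_smul]
    exact Submodule.smul_mem_smul h.mem hz

theorem eventually_ratliffRushFiltration_eq (h : IsSuperficialOn I M x)
    (hreg : IsSMulRegular M x) :
    ∀ᶠ n in atTop, (ratliffRushFiltration I M).N n = I ^ n • ⊤ := by
  obtain ⟨c, hc⟩ := eventually_atTop.1 (h.eventually_comap_eq hreg)
  have mem_of_pow_smul_mem {n : ℕ} (hn : c ≤ n) (N : ℕ) {z : M}
      (hz : x ^ N • z ∈ (I ^ (n + N) • ⊤ : Submodule R M)) : z ∈ (I ^ n • ⊤ : Submodule R M) := by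
    induction N with
    | zero => simpa using hz
    | succ N ih =>
      refine ih ((hc (n + N) (by lia)).le ?_)
      rwa [Submodule.mem_comap, LinearMap.lsmul_apply, smul_smul, ← pow_succ']
  filter_upwards [eventually_ge_atTop c] with n hn
  exact le_antisymm (fun z ⟨N, hN⟩ => mem_of_pow_smul_mem hn N (hN _ (Ideal.pow_mem_pow h.mem N)))
    (pow_smul_top_le_ratliffRushFiltration I n)

end IsSuperficialOn

theorem IsCohenMacaulayOfDim.exists_isSuperficialOn_isSMulRegular [IsLocalRing R]
    [Infinite (ResidueField R)] [IsNoetherianRing R] [Module.Finite R M] {I : Ideal R} {n : ℕ}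
    (h : IsCohenMacaulayOfDim R M (n + 1)) (hI : I.radical = maximalIdeal R) :
    ∃ x, IsSuperficialOn I M x ∧ IsSMulRegular M x := by
  obtain ⟨x, hx⟩ := exists_isSuperficialOn I M
  exact ⟨x, hx, hx.isSMulRegular_of_isCohenMacaulayOfDim hI h⟩

theorem IsCohenMacaulayOfDim.eventually_ratliffRushFiltration_eq [IsLocalRing R]
    [Infinite (ResidueField R)] [IsNoetherianRing R] [Module.Finite R M] {I : Ideal R} {n : ℕ}
    (h : IsCohenMacaulayOfDim R M (n + 1)) (hI : I.radical = maximalIdeal R) :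
    ∀ᶠ n in atTop, (ratliffRushFiltration I M).N n = I ^ n • ⊤ := by
  obtain ⟨x, hx, hreg⟩ := h.exists_isSuperficialOn_isSMulRegular hI
  exact hx.eventually_ratliffRushFiltration_eq hreg

end Existence

section Numerics

/-- The `s`-th forward difference of `F` attains its supremum at all large integers. -/
def HasEventuallyMaximalDiff (s : ℕ) (F : ℕ → ℚ) : Prop :=
  ∃ e, (∀ n, (Δ_[1])^[s] F n ≤ e) ∧ ∀ᶠ n in atTop, (Δ_[1])^[s] F n = e

theorem HasEventuallyMaximalDiff.of_succ_eq_add {s : ℕ} {F G : ℕ → ℚ}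
    (h : HasEventuallyMaximalDiff s G) (hFG : ∀ n, F (n + 1) = F n + G (n + 1)) :
    HasEventuallyMaximalDiff (s + 1) F := by
  obtain ⟨e, hle, heq⟩ := h
  have hΔ (n : ℕ) : (Δ_[1])^[s + 1] F n = (Δ_[1])^[s] G (n + 1) := by
    have hΔF : Δ_[1] F = fun n => G (n + 1) := funext fun n => by
      rw [fwdDiff, hFG, add_sub_cancel_left]
    rw [Function.iterate_succ_apply, hΔF, fwdDiff_iter_comp_add]
  refine ⟨e, fun n => hΔ n ▸ hle (n + 1), ?_⟩
  filter_upwards [(tendsto_add_atTop_nat 1).eventually heq] with n hn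
  exact (hΔ n).trans hn

theorem fwdDiff_iter_eventuallyEq {f g : ℕ → ℚ} (h : f =ᶠ[atTop] g) (s : ℕ) :
    (Δ_[1])^[s] f =ᶠ[atTop] (Δ_[1])^[s] g := by
  induction s with
  | zero => exact h
  | succ s ih =>
    simp only [Function.iterate_succ_apply']
    filter_upwards [ih, (tendsto_add_atTop_nat 1).eventually ih] with n hn hn'
    rw [fwdDiff, fwdDiff, hn, hn']

theorem exists_eval_eq_of_fwdDiff_iter_eventuallyEq_const {s : ℕ} {F : ℕ → ℚ} {e : ℚ}
    (h : ∀ᶠ n in atTop, (Δ_[1])^[s] F n = e) :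
    ∃ P : ℚ[X], ∀ᶠ n : ℕ in atTop, P.eval (n : ℚ) = F n := by
  obtain ⟨c, hc⟩ := eventually_atTop.1 h
  have higher_eq_zero (j : ℕ) : ∀ n ≥ c, (Δ_[1])^[s + 1 + j] F n = 0 := by
    induction j with
    | zero =>
      intro n hn
      rw [add_zero, Function.iterate_succ_apply', fwdDiff, hc n hn, hc _ (by lia), sub_self]
    | succ j ih =>
      intro n hn
      rw [← add_assoc, Function.iterate_succ_apply', fwdDiff, ih n hn, ih _ (by lia), sub_self]
  refine ⟨∑ k ∈ Finset.range (s + 1),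
    C ((Δ_[1])^[k] F c / k.factorial) * (descPochhammer ℚ k).comp (X - C (c : ℚ)), ?_⟩
  filter_upwards [eventually_ge_atTop c] with n hn
  obtain ⟨m, rfl⟩ := Nat.exists_eq_add_of_le hn
  have newton := shift_eq_sum_fwdDiff_iter 1 F m c
  rw [smul_eq_mul, mul_one] at newton
  rw [newton, eval_finsetSum]
  have summand (k : ℕ) : (C ((Δ_[1])^[k] F c / k.factorial) *
      (descPochhammer ℚ k).comp (X - C (c : ℚ))).eval ((c + m : ℕ) : ℚ) =
      m.choose k • (Δ_[1])^[k] F c := by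
    simp [descPochhammer_eval_eq_descFactorial, Nat.descFactorial_eq_factorial_mul_choose]
    field_simp
  simp only [summand]
  rw [Finset.sum_subset (Finset.range_mono (le_max_left (s + 1) (m + 1))),
    ← Finset.sum_subset (Finset.range_mono (le_max_right (s + 1) (m + 1)))]
  · intro k _ hk
    rw [Nat.choose_eq_zero_of_lt (by simpa using hk), zero_smul]
  · intro k _ hk
    obtain ⟨j, rfl⟩ := Nat.exists_eq_add_of_le (not_lt.1 (mt Finset.mem_range.2 hk))
    rw [higher_eq_zero j c le_rfl, smul_zero]

theorem exists_fwdDiff_iter_eval_eq (P : ℚ[X]) (s : ℕ) :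
    ∃ Q : ℚ[X], ∀ n : ℕ, (Δ_[1])^[s] (fun n : ℕ => P.eval (n : ℚ)) n = Q.eval (n : ℚ) := by
  induction s with
  | zero => exact ⟨P, fun _ => rfl⟩
  | succ s ih =>
    obtain ⟨Q, hQ⟩ := ih
    refine ⟨taylor 1 Q - Q, fun n => ?_⟩
    rw [Function.iterate_succ_apply', fwdDiff, hQ, hQ, eval_sub, taylor_eval, Nat.cast_succ]

theorem eval_eq_of_eventually_eval_eq {P : ℚ[X]} {e : ℚ}
    (h : ∀ᶠ n : ℕ in atTop, P.eval (n : ℚ) = e) (q : ℚ) : P.eval q = e := by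
  have hinf : {q : ℚ | P.eval q = (C e).eval q}.Infinite :=
    ((Nat.frequently_atTop_iff_infinite.1 h.frequently).image
      Nat.cast_injective.injOn).mono (by rintro _ ⟨n, hn, rfl⟩; simpa using hn)
  rw [eq_of_infinite_eval_eq P (C e) hinf, eval_C]

theorem monotone_neg_one_pow_mul_of_fwdDiff_iter_nonneg {d : ℕ} {f : ℕ → ℚ}
    (h : ∀ n, 0 ≤ (Δ_[1])^[d + 1] f n) (h0 : ∀ᶠ n in atTop, f n = 0) :
    Monotone fun n => (-1) ^ d * f n := by
  refine monotone_nat_of_le_succ fun n => ?_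
  rw [← sub_nonneg, ← mul_sub]
  change 0 ≤ (-1) ^ d * Δ_[1] f n
  induction d generalizing f n with
  | zero => simpa using h n
  | succ d ih =>
    have hΔ0 : ∀ᶠ n in atTop, Δ_[1] f n = 0 := by
      filter_upwards [h0, (tendsto_add_atTop_nat 1).eventually h0] with n hn hn'
      rw [fwdDiff, hn, hn', sub_self]
    have hmono : Monotone fun n => (-1) ^ d * Δ_[1] f n := monotone_nat_of_le_succ fun n => by
      rw [← sub_nonneg, ← mul_sub]
      exact ih h hΔ0 n
    obtain ⟨c, hc⟩ := eventually_atTop.1 hΔ0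
    have := hmono (le_max_left n c)
    simp only [hc _ (le_max_right n c), mul_zero] at this
    rw [pow_succ]
    linarith

theorem HasEventuallyMaximalDiff.eval_eq {d : ℕ} {F : ℕ → ℚ}
    (h : HasEventuallyMaximalDiff (d + 1) F) {P : ℚ[X]}
    (hP : ∀ᶠ n : ℕ in atTop, P.eval (n : ℚ) = F n) {k : ℕ} (hk : P.eval (k : ℚ) = F k) {n : ℕ}
    (hn : k ≤ n) : P.eval (n : ℚ) = F n := by
  obtain ⟨e, hle, heq⟩ := h
  obtain ⟨Q, hQ⟩ := exists_fwdDiff_iter_eval_eq P (d + 1)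
  have hQe := eval_eq_of_eventually_eval_eq (P := Q) (e := e) <| by
    filter_upwards [heq, fwdDiff_iter_eventuallyEq hP (d + 1)] with n hn hn'
    rw [← hQ, hn', hn]
  let f : ℕ → ℚ := (fun n : ℕ => P.eval (n : ℚ)) + (-1 : ℚ) • F
  have hf0 : ∀ᶠ n in atTop, f n = 0 := hP.mono fun n hn => by simp [f, hn]
  have hf : Monotone fun n => (-1) ^ d * f n := by
    refine monotone_neg_one_pow_mul_of_fwdDiff_iter_nonneg (fun n => ?_) hf0
    rw [fwdDiff_iter_add, fwdDiff_iter_const_smul, Pi.add_apply, hQ, hQe]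
    simpa using hle n
  obtain ⟨c, hc⟩ := eventually_atTop.1 hf0
  have hfk : f k = 0 := by simp [f, hk]
  have hfn : (-1) ^ d * f n = 0 := le_antisymm
    (by simpa [hc _ (le_max_right n c)] using hf (le_max_left n c))
    (by simpa [hfk] using hf hn)
  have : f n = 0 := by simpa using hfn
  simpa [f, ← sub_eq_add_neg, sub_eq_zero] using this

end Numerics

section Length

variable {R : Type u} [CommRing R]
  {M₁ M₂ M₃ : Type*} [AddCommGroup M₁] [Module R M₁] [AddCommGroup M₂] [Module R M₂]
  [AddCommGroup M₃] [Module R M₃]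

theorem length_quotient_eq_add_of_exact {f : M₁ →ₗ[R] M₂} {g : M₂ →ₗ[R] M₃}
    (hfg : Function.Exact f g) (hg : Function.Surjective g) (N : Submodule R M₂) :
    Module.length R (M₂ ⧸ N) =
      Module.length R (M₁ ⧸ N.comap f) + Module.length R (M₃ ⧸ N.map g) := by
  refine Module.length_eq_add_of_exact (Submodule.mapQ _ N f le_rfl)
    (Submodule.mapQ N _ g (Submodule.le_comap_map g N)) ?_ ?_ ?_
  · rw [← LinearMap.ker_eq_bot, Submodule.ker_mapQ, Submodule.mkQ_map_self]
  · exact LinearMap.range_eq_top.1 (by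
      rw [Submodule.range_mapQ, LinearMap.range_eq_top.2 hg, Submodule.map_top,
        Submodule.range_mkQ])
  · exact (Function.Exact.exact_mapQ_iff hfg _ _).2 inf_le_right

variable {M : Type v} [AddCommGroup M] [Module R M] [IsLocalRing R] [IsNoetherianRing R]
  [Module.Finite R M]

theorem length_ne_top_of_maximalIdeal_le_radical_annihilator
    (h : maximalIdeal R ≤ (Module.annihilator R M).radical) : Module.length R M ≠ ⊤ := by
  obtain ⟨k, hk⟩ := Ideal.exists_pow_le_of_le_radical_of_fg h (IsNoetherian.noetherian _)
  have : IsArtinianRing (R ⧸ maximalIdeal R ^ (k + 1)) := by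
    apply IsLocalRing.quotient_artinian_of_mem_minimalPrimes_of_isLocalRing
    rw [← Ideal.radical_minimalPrimes, Ideal.radical_pow _ k.succ_ne_zero,
      (maximalIdeal.isMaximal R).isPrime.radical, Ideal.minimalPrimes_eq_subsingleton_self]
    rfl
  let : Module (R ⧸ maximalIdeal R ^ (k + 1)) M := Module.IsTorsionBySet.module fun z a =>
    Module.mem_annihilator.1 (hk (Ideal.pow_le_pow_right k.le_succ a.2)) z
  have : IsScalarTower R (R ⧸ maximalIdeal R ^ (k + 1)) M :=
    Module.IsTorsionBySet.isScalarTower _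
  have : Module.Finite (R ⧸ maximalIdeal R ^ (k + 1)) M := .of_restrictScalars_finite R _ M
  have : IsArtinian R M :=
    isArtinian_of_surjective_algebraMap (R := R ⧸ maximalIdeal R ^ (k + 1))
      Ideal.Quotient.mk_surjective
  exact Module.length_ne_top

theorem length_quotient_ne_top {I : Ideal R} (hI : I.radical = maximalIdeal R) {n : ℕ}
    {N : Submodule R M} (hN : I ^ n • ⊤ ≤ N) : Module.length R (M ⧸ N) ≠ ⊤ := by
  refine length_ne_top_of_maximalIdeal_le_radical_annihilator ?_
  have hn : I ^ n ≤ Module.annihilator R (M ⧸ N) := by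
    rw [Submodule.annihilator_quotient]
    exact fun a ha => Submodule.mem_colon.2 fun m _ => hN (Submodule.smul_mem_smul ha trivial)
  rw [← hI, Ideal.radical_le_radical_iff]
  exact (Ideal.radical_mono hn).trans' fun a ha => ⟨n, Ideal.pow_mem_pow ha n⟩

namespace IsCohenMacaulayOfDim

theorem length_ne_top (h : IsCohenMacaulayOfDim R M 0) : Module.length R M ≠ ⊤ :=
  length_ne_top_of_maximalIdeal_le_radical_annihilator h.maximalIdeal_le_radical_annihilator

theorem eventually_pow_smul_top_eq_bot (h : IsCohenMacaulayOfDim R M 0) {I : Ideal R}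
    (hI : I ≤ maximalIdeal R) : ∀ᶠ n in atTop, (I ^ n • ⊤ : Submodule R M) = ⊥ := by
  obtain ⟨k, hk⟩ := Ideal.exists_pow_le_of_le_radical_of_fg
    (hI.trans h.maximalIdeal_le_radical_annihilator) (IsNoetherian.noetherian I)
  filter_upwards [eventually_ge_atTop k] with n hn
  rw [eq_bot_iff, Submodule.smul_le]
  exact fun a ha m _ => Module.mem_annihilator.1 (hk (Ideal.pow_le_pow_right hn ha)) m

end IsCohenMacaulayOfDim

end Length

section HilbertFunction

variable {R : Type u} [CommRing R] {I : Ideal R} {M : Type v} [AddCommGroup M] [Module R M]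
  {M' : Type*} [AddCommGroup M'] [Module R M'] {𝓕 : I.Filtration M} {x : R} {g : M →ₗ[R] M'}

/-- The image of a filtration under a linear map. -/
@[simps]
def filtrationMap (𝓕 : I.Filtration M) (g : M →ₗ[R] M') : I.Filtration M' where
  N n := (𝓕.N n).map g
  mono n := Submodule.map_mono (𝓕.mono n)
  smul_le n := by
    rw [← Submodule.map_smul'']
    exact Submodule.map_mono (𝓕.smul_le n)

theorem filtrationMap_N_zero (h0 : 𝓕.N 0 = ⊤) (hg : Function.Surjective g) :
    (filtrationMap 𝓕 g).N 0 = ⊤ := by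
  rw [filtrationMap_N, h0, Submodule.map_top, LinearMap.range_eq_top.2 hg]

/-- The Hilbert function `n ↦ λ(M / 𝓕 n)` of a filtration. It takes the junk value `0` at `n` if
the length is infinite. -/
noncomputable def hilbertFun (𝓕 : I.Filtration M) (n : ℕ) : ℕ :=
  (Module.length R (M ⧸ 𝓕.N n)).toNat

theorem hilbertFun_le_length (h : Module.length R M ≠ ⊤) (n : ℕ) :
    hilbertFun 𝓕 n ≤ (Module.length R M).toNat :=
  ENat.toNat_le_toNat (Module.length_le_of_surjective _ (𝓕.N n).mkQ_surjective) h

theorem hilbertFun_eq_length_of_eq_bot {n : ℕ} (h : 𝓕.N n = ⊥) :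
    hilbertFun 𝓕 n = (Module.length R M).toNat := by
  rw [hilbertFun, (Submodule.quotEquivOfEqBot _ h).length_eq]

variable [IsLocalRing R] [IsNoetherianRing R] [Module.Finite R M]

theorem coe_hilbertFun (hI : I.radical = maximalIdeal R) (h0 : 𝓕.N 0 = ⊤) (n : ℕ) :
    (hilbertFun 𝓕 n : ℕ∞) = Module.length R (M ⧸ 𝓕.N n) :=
  ENat.natCast_toNat <| length_quotient_ne_top (n := n) hI <| by simpa [h0] using 𝓕.pow_smul_le n 0

theorem length_quotient_comap_add_hilbertFun (hI : I.radical = maximalIdeal R) (h0 : 𝓕.N 0 = ⊤)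
    (hexact : Function.Exact (LinearMap.lsmul R M x) g) (hg : Function.Surjective g) (n : ℕ) :
    Module.length R (M ⧸ (𝓕.N n).comap (LinearMap.lsmul R M x)) + hilbertFun (filtrationMap 𝓕 g) n =
      hilbertFun 𝓕 n := by
  have := Module.Finite.of_surjective g hg
  rw [coe_hilbertFun hI h0, coe_hilbertFun hI (filtrationMap_N_zero h0 hg)]
  exact (length_quotient_eq_add_of_exact hexact hg (𝓕.N n)).symm

theorem hilbertFun_succ_eq_add (hI : I.radical = maximalIdeal R) (h0 : 𝓕.N 0 = ⊤)
    (hexact : Function.Exact (LinearMap.lsmul R M x) g) (hg : Function.Surjective g) {n : ℕ}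
    (hcomap : (𝓕.N (n + 1)).comap (LinearMap.lsmul R M x) = 𝓕.N n) :
    hilbertFun 𝓕 (n + 1) = hilbertFun 𝓕 n + hilbertFun (filtrationMap 𝓕 g) (n + 1) := by
  have := length_quotient_comap_add_hilbertFun hI h0 hexact hg (n + 1)
  rw [hcomap, ← coe_hilbertFun hI h0] at this
  exact_mod_cast this.symm

theorem hilbertFun_succ_le_add (hI : I.radical = maximalIdeal R) (h0 : 𝓕.N 0 = ⊤) (hx : x ∈ I)
    (hexact : Function.Exact (LinearMap.lsmul R M x) g) (hg : Function.Surjective g) (n : ℕ) :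
    hilbertFun 𝓕 (n + 1) ≤ hilbertFun 𝓕 n + hilbertFun (filtrationMap 𝓕 g) (n + 1) := by
  have hle : 𝓕.N n ≤ (𝓕.N (n + 1)).comap (LinearMap.lsmul R M x) := fun m hm =>
    𝓕.smul_le n (Submodule.smul_mem_smul hx hm)
  have hlength := Module.length_le_of_surjective _ (Submodule.factor_surjective hle)
  rw [← Nat.cast_le (α := ℕ∞), Nat.cast_add,
    ← length_quotient_comap_add_hilbertFun hI h0 hexact hg, coe_hilbertFun hI h0 n]
  gcongr

theorem hasEventuallyMaximalDiff_one [Infinite (ResidueField R)] [Small.{v} R]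
    (hI : I.radical = maximalIdeal R) (hM : IsCohenMacaulayOfDim R M 1) (h0 : 𝓕.N 0 = ⊤)
    (h𝓕 : ∀ᶠ n in atTop, 𝓕.N n = I ^ n • ⊤) :
    HasEventuallyMaximalDiff 1 (fun n => hilbertFun 𝓕 n) := by
  obtain ⟨b, hb, hreg⟩ := hM.exists_isSuperficialOn_isSMulRegular hI
  have hIm : I ≤ maximalIdeal R := hI ▸ Ideal.le_radical
  let g := (b • ⊤ : Submodule R M).mkQ
  have hg : Function.Surjective g := Submodule.mkQ_surjective _
  have hexact := LinearMap.exact_lsmul_mkQ_smul_top M b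
  have hM' := hM.of_exact (hIm hb.mem) hreg hexact hg
  refine ⟨(Module.length R (QuotSMulTop b M)).toNat, fun n => ?_, ?_⟩
  · have := (hilbertFun_succ_le_add hI h0 hb.mem hexact hg n).trans
      (Nat.add_le_add_left (hilbertFun_le_length hM'.length_ne_top _) _)
    rw [Function.iterate_one, fwdDiff, sub_le_iff_le_add']
    exact_mod_cast this
  · filter_upwards [h𝓕, (tendsto_add_atTop_nat 1).eventually h𝓕, hb.eventually_comap_eq hreg,
      (tendsto_add_atTop_nat 1).eventually (hM'.eventually_pow_smul_top_eq_bot hIm)]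
      with n hn hn' hcomap hbot
    have hmap : (filtrationMap 𝓕 g).N (n + 1) = ⊥ := by
      rw [filtrationMap_N, hn', Submodule.map_smul'', Submodule.map_top,
        LinearMap.range_eq_top.2 hg, hbot]
    rw [Function.iterate_one, fwdDiff, sub_eq_iff_eq_add', ← hilbertFun_eq_length_of_eq_bot hmap]
    exact_mod_cast hilbertFun_succ_eq_add hI h0 hexact hg (by rw [hn, hn', hcomap])

theorem IsSuperficialOn.hasEventuallyMaximalDiff_succ (hx : IsSuperficialOn I M x)
    (hI : I.radical = maximalIdeal R) (hexact : Function.Exact (LinearMap.lsmul R M x) g)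
    (hg : Function.Surjective g) {s : ℕ} (h : HasEventuallyMaximalDiff s
      fun n => hilbertFun (filtrationMap (ratliffRushFiltration I M) g) n) :
    HasEventuallyMaximalDiff (s + 1) fun n => hilbertFun (ratliffRushFiltration I M) n :=
  h.of_succ_eq_add fun n => by
    exact_mod_cast hilbertFun_succ_eq_add hI ratliffRushFiltration_zero hexact hg
      (hx.comap_ratliffRushFiltration n)

theorem hasEventuallyMaximalDiff_two [Infinite (ResidueField R)] [Small.{v} R]
    (hI : I.radical = maximalIdeal R) (hM : IsCohenMacaulayOfDim R M 2) :
    HasEventuallyMaximalDiff 2 fun n => hilbertFun (ratliffRushFiltration I M) n := by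
  obtain ⟨a, ha, hreg⟩ := hM.exists_isSuperficialOn_isSMulRegular hI
  have hexact := LinearMap.exact_lsmul_mkQ_smul_top M a
  have hg := (a • ⊤ : Submodule R M).mkQ_surjective
  have hM' := hM.of_exact (hI ▸ Ideal.le_radical ha.mem) hreg hexact hg
  refine ha.hasEventuallyMaximalDiff_succ hI hexact hg <| hasEventuallyMaximalDiff_one hI hM'
    (filtrationMap_N_zero ratliffRushFiltration_zero hg) ?_
  filter_upwards [ha.eventually_ratliffRushFiltration_eq hreg] with n hn
  rw [filtrationMap_N, hn, Submodule.map_smul'', Submodule.map_top, LinearMap.range_eq_top.2 hg]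

end HilbertFunction

section InitialIdeal

variable {R : Type u} [CommRing R] {I : Ideal R} {s : ℕ} {x : Fin s → R}

/-- The ideal generated by the terms `x 0, …, x (i - 1)` of a finite sequence. -/
def initialIdeal (x : Fin s → R) (i : ℕ) : Ideal R :=
  Ideal.span (x '' {j | (j : ℕ) < i})

theorem initialIdeal_zero (x : Fin s → R) : initialIdeal x 0 = ⊥ := by
  simp [initialIdeal]

theorem initialIdeal_self (x : Fin s → R) : initialIdeal x s = Ideal.span (Set.range x) := by
  simp [initialIdeal]

theorem initialIdeal_succ (x : Fin s → R) {i : ℕ} (hi : i < s) :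
    initialIdeal x (i + 1) = initialIdeal x i ⊔ Ideal.span {x ⟨i, hi⟩} := by
  have : {j : Fin s | (j : ℕ) < i + 1} = {j : Fin s | (j : ℕ) < i} ∪ {⟨i, hi⟩} := by
    ext j
    simp only [Set.mem_ofPred_eq, Set.mem_union, Set.mem_singleton_iff, Fin.ext_iff]
    lia
  rw [initialIdeal, this, Set.image_union, Set.image_singleton, Ideal.span_union, initialIdeal]

theorem initialIdeal_le_succ (x : Fin s → R) (i : ℕ) : initialIdeal x i ≤ initialIdeal x (i + 1) :=
  Ideal.span_mono (Set.image_mono fun _ hj => Nat.lt_succ_of_lt hj)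

/-- The projection `R / (x 0, …, x (i - 1)) → R / (x 0, …, x i)`. -/
abbrev initialIdealFactor (x : Fin s → R) (i : ℕ) :
    (R ⧸ initialIdeal x i) →ₗ[R] R ⧸ initialIdeal x (i + 1) :=
  Submodule.factor (initialIdeal_le_succ x i)

theorem exact_lsmul_initialIdealFactor (x : Fin s → R) {i : ℕ} (hi : i < s) :
    Function.Exact (LinearMap.lsmul R (R ⧸ initialIdeal x i) (x ⟨i, hi⟩))
      (initialIdealFactor x i) := by
  intro z
  obtain ⟨r, rfl⟩ := Submodule.mkQ_surjective _ z
  have hmem : r ∈ initialIdeal x (i + 1) ↔ ∃ t, x ⟨i, hi⟩ * t - r ∈ initialIdeal x i := by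
    rw [initialIdeal_succ x hi, sup_comm, Ideal.mem_span_singleton_sup]
    constructor
    · rintro ⟨t, b, hb, rfl⟩
      exact ⟨t, by simpa [mul_comm] using hb⟩
    · rintro ⟨t, ht⟩
      exact ⟨t, r - x ⟨i, hi⟩ * t, by simpa using neg_mem ht, by ring⟩
  rw [Submodule.factor_mk, Submodule.mkQ_apply, Submodule.Quotient.mk_eq_zero, hmem]
  simp only [Set.mem_range, (Submodule.mkQ_surjective (initialIdeal x i)).exists,
    LinearMap.lsmul_apply, Submodule.mkQ_apply, ← Submodule.Quotient.mk_smul,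
    Submodule.Quotient.eq, smul_eq_mul]

theorem IsSuperficialSeq.isSuperficialOn (h : IsSuperficialSeq I x) (hxI : ∀ i, x i ∈ I) {i : ℕ}
    (hi : i < s) : IsSuperficialOn I (R ⧸ initialIdeal x i) (x ⟨i, hi⟩) :=
  IsSuperficial.isSuperficialOn (hxI _) (h ⟨i, hi⟩)

theorem RatliffRushBehavesWell.map_mkQ_ratliffRushFiltration (h : RatliffRushBehavesWell I x)
    (n : ℕ) : ((ratliffRushFiltration I R).N n).map (Ideal.span (Set.range x)).mkQ =
      (ratliffRushFiltration I (R ⧸ Ideal.span (Set.range x))).N n := by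
  obtain rfl | hn := n.eq_zero_or_pos
  · rw [ratliffRushFiltration_zero, ratliffRushFiltration_zero, Submodule.map_top,
      Submodule.range_mkQ]
  · have h := h n hn
    rw [Ideal.map_pow, ratliffRush_pow_eq I hn, ratliffRush_pow_eq _ hn] at h
    ext z
    rw [← mem_ratliffRushFiltration_map, Ideal.Quotient.algebraMap_eq, ← h,
      Ideal.mem_map_iff_of_surjective _ Ideal.Quotient.mk_surjective]
    rfl

theorem RatliffRushBehavesWell.map_mkQ_initialIdeal (hbw : RatliffRushBehavesWell I x)
    (hx : IsSuperficialSeq I x) (hxI : ∀ i, x i ∈ I) {i : ℕ} (hi : i ≤ s) (n : ℕ) :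
    ((ratliffRushFiltration I R).N n).map (initialIdeal x i).mkQ =
      (ratliffRushFiltration I (R ⧸ initialIdeal x i)).N n := by
  induction hi using Nat.decreasingInduction generalizing n with
  | self =>
    rw [initialIdeal_self]
    exact hbw.map_mkQ_ratliffRushFiltration n
  | of_succ i hi ih =>
    refine (hx.isSuperficialOn hxI hi).map_ratliffRushFiltration_eq (Submodule.mkQ_surjective _)
      (exact_lsmul_initialIdealFactor x hi) ?_ n
    rwa [Submodule.factor_comp_mk]

theorem RatliffRushBehavesWell.filtrationMap_initialIdealFactor (hbw : RatliffRushBehavesWell I x)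
    (hx : IsSuperficialSeq I x) (hxI : ∀ i, x i ∈ I) {i : ℕ} (hi : i < s) :
    filtrationMap (ratliffRushFiltration I (R ⧸ initialIdeal x i)) (initialIdealFactor x i) =
      ratliffRushFiltration I (R ⧸ initialIdeal x (i + 1)) := by
  ext1
  funext n
  rw [filtrationMap_N, ← hbw.map_mkQ_initialIdeal hx hxI hi.le,
    ← hbw.map_mkQ_initialIdeal hx hxI hi, ← Submodule.map_comp, Submodule.factor_comp_mk]

variable [IsLocalRing R] [IsNoetherianRing R]

theorem IsSuperficialSeq.isCohenMacaulayOfDim_quotient (hx : IsSuperficialSeq I x)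
    (hxI : ∀ i, x i ∈ I) (hI : I.radical = maximalIdeal R) {k : ℕ}
    (hR : IsCohenMacaulayOfDim R R (s + k)) :
    IsCohenMacaulayOfDim R (R ⧸ initialIdeal x s) k := by
  suffices h : ∀ i m, i + m = s → IsCohenMacaulayOfDim R (R ⧸ initialIdeal x i) (m + k) by
    simpa using h s 0 (add_zero s)
  intro i
  induction i with
  | zero =>
    rintro m rfl
    exact (zero_add m ▸ hR).congr (Submodule.quotEquivOfEqBot _ (initialIdeal_zero x)).symm
  | succ i ih =>
    intro m hm
    have hi : i < s := by lia
    have hsup := hx.isSuperficialOn hxI hi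
    have hM := add_right_comm m 1 k ▸ ih (m + 1) (by lia)
    exact hM.of_exact (hI ▸ Ideal.le_radical (hxI _))
      (hsup.isSMulRegular_of_isCohenMacaulayOfDim hI hM) (exact_lsmul_initialIdealFactor x hi)
      (Submodule.factor_surjective _)

theorem RatliffRushBehavesWell.hasEventuallyMaximalDiff_add (hbw : RatliffRushBehavesWell I x)
    (hx : IsSuperficialSeq I x) (hxI : ∀ i, x i ∈ I) (hI : I.radical = maximalIdeal R) {k : ℕ}
    (h : HasEventuallyMaximalDiff k
      fun n => hilbertFun (ratliffRushFiltration I (R ⧸ initialIdeal x s)) n) :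
    HasEventuallyMaximalDiff (s + k) fun n => hilbertFun (ratliffRushFiltration I R) n := by
  have descend (i : ℕ) (hi : i ≤ s) : HasEventuallyMaximalDiff (s - i + k)
      fun n => hilbertFun (ratliffRushFiltration I (R ⧸ initialIdeal x i)) n := by
    induction hi using Nat.decreasingInduction with
    | self => simpa using h
    | of_succ i hi ih =>
      rw [← hbw.filtrationMap_initialIdealFactor hx hxI hi] at ih
      rw [show s - i + k = s - (i + 1) + k + 1 by lia]
      exact (hx.isSuperficialOn hxI hi).hasEventuallyMaximalDiff_succ hI
        (exact_lsmul_initialIdealFactor x hi) (Submodule.factor_surjective _) ih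
  have hilbertFun_eq (n : ℕ) : hilbertFun (ratliffRushFiltration I (R ⧸ initialIdeal x 0)) n =
      hilbertFun (ratliffRushFiltration I R) n := by
    rw [hilbertFun, hilbertFun, ← hbw.map_mkQ_initialIdeal hx hxI s.zero_le,
      (Submodule.quotientQuotientEquivQuotient _ _ ?_).length_eq]
    exact (initialIdeal_zero x).le.trans bot_le
  simpa only [hilbertFun_eq, Nat.sub_zero] using descend 0 s.zero_le

end InitialIdeal

section HilbertSamuel

variable {R : Type u} [CommRing R] {I : Ideal R}

theorem IsCohenMacaulayLocal.isCohenMacaulayOfDim [IsLocalRing R] [IsCohenMacaulayLocal R] {d : ℕ}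
    (hd : ringKrullDim R = d) : IsCohenMacaulayOfDim R R d := by
  obtain ⟨rs, hmem, hreg, hlen⟩ := exists_regular (R := R)
  rw [hd] at hlen
  exact ⟨(Module.supportDim_self_eq_ringKrullDim R).trans hd,
    rs, by exact_mod_cast hlen, hmem, hreg⟩

theorem one_le_stabilityIndex_and_ratliffRush_pow_eq
    (h : ∀ᶠ n in atTop, (ratliffRushFiltration I R).N n = I ^ n) :
    1 ≤ stabilityIndex I ∧ ∀ n ≥ stabilityIndex I, ratliffRush (I ^ n) = I ^ n := by
  obtain ⟨c, hc⟩ := eventually_atTop.1 h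
  refine Nat.sInf_mem (s := {i | 1 ≤ i ∧ ∀ n, i ≤ n → ratliffRush (I ^ n) = I ^ n})
    ⟨c + 1, by lia, fun n hn => ?_⟩
  rw [ratliffRush_pow_eq I (by lia), hc n (by lia)]

theorem hilbertFun_ratliffRushFiltration_eq_hilbertSamuelFun
    (h : ∀ᶠ n in atTop, (ratliffRushFiltration I R).N n = I ^ n) {n : ℕ}
    (hn : stabilityIndex I ≤ n) :
    hilbertFun (ratliffRushFiltration I R) n = hilbertSamuelFun I n := by
  obtain ⟨hpos, hstable⟩ := one_le_stabilityIndex_and_ratliffRush_pow_eq h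
  rw [hilbertFun, ← ratliffRush_pow_eq I (hpos.trans hn), hstable n hn, hilbertSamuelFun]

theorem eventually_eval_hilbertSamuelPoly_eq {s : ℕ} {F : ℕ → ℚ} {e : ℚ}
    (hΔ : ∀ᶠ n in atTop, (Δ_[1])^[s] F n = e) (hF : ∀ᶠ n in atTop, F n = hilbertSamuelFun I n) :
    ∀ᶠ n : ℕ in atTop, (hilbertSamuelPoly I).eval (n : ℚ) = F n := by
  obtain ⟨P, hP⟩ := exists_eval_eq_of_fwdDiff_iter_eventuallyEq_const hΔ
  have h : ∃ P : ℚ[X], ∀ᶠ n : ℕ in atTop, P.eval (n : ℚ) = hilbertSamuelFun I n :=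
    ⟨P, by filter_upwards [hP, hF] with n hn hn' using hn.trans hn'⟩
  rw [hilbertSamuelPoly, dif_pos h]
  filter_upwards [h.choose_spec, hF] with n hn hn' using hn.trans hn'.symm

end HilbertSamuel

theorem corollary5p7 {R : Type*} [CommRing R] [IsLocalRing R] [IsNoetherianRing R]
    [IsCohenMacaulayLocal R] [Infinite (ResidueField R)]
    (d : ℕ) (hd : 2 ≤ d) (hdim : ringKrullDim R = (d : WithBot ℕ∞))
    (I : Ideal R) (hI : I.radical = maximalIdeal R)
    (x : Fin (d - 2) → R) (hxI : ∀ i, x i ∈ I) (hx : IsSuperficialSeq I x)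
    (hbw : RatliffRushBehavesWell I x)
    (k : ℕ) (hk : stabilityIndex I ≤ k)
    (hPH : (hilbertSamuelPoly I).eval (k : ℚ) = (hilbertSamuelFun I k : ℚ)) :
    ∀ n : ℕ, k ≤ n →
      (hilbertSamuelPoly I).eval (n : ℚ) = (hilbertSamuelFun I n : ℚ) := by
  generalize hs : d - 2 = s at x hxI hx hbw
  obtain rfl : d = s + 2 := by lia
  have hR : IsCohenMacaulayOfDim R R (s + 2) := IsCohenMacaulayLocal.isCohenMacaulayOfDim hdim
  have hdiff := hbw.hasEventuallyMaximalDiff_add hx hxI hI <|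
    hasEventuallyMaximalDiff_two hI (hx.isCohenMacaulayOfDim_quotient hxI hI hR)
  have hstable : ∀ᶠ n in atTop, (ratliffRushFiltration I R).N n = I ^ n := by
    simpa only [smul_eq_mul, Ideal.mul_top] using hR.eventually_ratliffRushFiltration_eq hI
  have hHF (n : ℕ) (hn : k ≤ n) :
      (hilbertFun (ratliffRushFiltration I R) n : ℚ) = hilbertSamuelFun I n :=
    congrArg _ (hilbertFun_ratliffRushFiltration_eq_hilbertSamuelFun hstable (hk.trans hn))
  have ⟨_, _, hΔ⟩ := hdiff
  have hP := eventually_eval_hilbertSamuelPoly_eq hΔ (eventually_atTop.2 ⟨k, hHF⟩)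
  intro n hn
  rw [← hHF n hn]
  exact hdiff.eval_eq hP (hPH.trans (hHF k le_rfl).symm) hn
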